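/- Let $G=(V,E)$ be a connected finite simple graph with a measure $\mu:V\to(0,\infty)$ and positive symmetric edge weights $w_{xy}=w_{yx}>0$ ($xy\in E$), and let $$\Delta u(x)=\frac1{\mu(x)}\sum_{y\sim x}w_{xy}\,(u(y)-u(x)),\qquad u:V\to\mathbb R .$$ Let $h_1,h_2:V\to\mathbb R$ with $h_1(x)>0$ for all $x\in V$, let $A,B>0$ be constants, and define $F_{h_1,h_2}:\mathbb R^V\to\mathbb R^V$ by $$F_{h_1,h_2}(u)=-\Delta u+h_1e^{Au}+h_2e^{-Bu}.$$ For $R>0$ put $B_R=\{u\in\mathbb R^V:\max_V|u|<R\}$. If $\max_V h_2<0$ or $\min_V h_2>0$, then there is a constant $K$ such that for all $R>K$ the map $F_{h_1,h_2}$ has no zero on $\partial B_R$ and the Brouwer degree $\deg(F_{h_1,h_2},B_R,0)$ does not depend on $R$. Its value $\mathbf d_{h_1,h_2}=\lim_{R\to+\infty}\deg(F_{h_1,h_2},B_R,0)$ is $$\mathbf d_{h_1,h_2}=\begin{cases}1,&\max_V h_2<0,\\ 0,&\min_V h_2>0.\end{cases}$$ Consequently, if $\max_V h_2<0$, the Tzitzéica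 equation $-\Delta u+h_1e^{Au}+h_2e^{-Bu}=0$ has at least one solution $u:V\to\mathbb R$. -/

import Mathlib

open Filter Topology

noncomputable section

namespace Tzitzeica

section Degree

variable {E : Type*} [NormedAddCommGroup E] [NormedSpace ℝ E]

/-- The triples `(f, Ω, y)` for which the Brouwer degree is defined: `Ω` is a bounded open set,
`f` is continuous on the closure of `Ω`, and `y` is not a value of `f` on the boundary of `Ω`. -/
structure DegreeAdmissible (f : E → E) (Ω : Set E) (y : E) : Prop where
  isOpen : IsOpen Ω
  isBounded : Bornology.IsBounded Ω
  continuousOn : ContinuousOn f (closure Ω)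
  notMem_boundary : y ∉ f '' frontier Ω

/-- `f` is `C¹` in `Ω` and `y` is a regular value of `f` in `Ω`. -/
structure IsRegularOn (f : E → E) (Ω : Set E) (y : E) : Prop where
  contDiffOn : ContDiffOn ℝ 1 f Ω
  regular : ∀ x ∈ Ω, f x = y → (fderiv ℝ f x).det ≠ 0

/-- The sum of `sgn det Df(x)` over the solutions `x ∈ Ω` of `f x = y`. -/
def signedCount (f : E → E) (Ω : Set E) (y : E) : ℤ :=
  ∑ᶠ x ∈ {x | x ∈ Ω ∧ f x = y}, ((SignType.sign (fderiv ℝ f x).det : SignType) : ℤ)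

/-- `g` is an admissible regular approximation of `f`: it is continuous on the closure of `Ω`,
`C¹` in `Ω` with regular value `y`, and `sup_{closure Ω} ‖g - f‖ < dist (y, f(∂Ω))`
(both are attained, `closure Ω` and `∂Ω` being compact). -/
structure IsRegularApprox (f g : E → E) (Ω : Set E) (y : E) : Prop where
  continuousOn : ContinuousOn g (closure Ω)
  isRegularOn : IsRegularOn g Ω y
  close : ∀ x ∈ closure Ω, ∀ z ∈ frontier Ω, ‖g x - f x‖ < ‖f z - y‖

open Classical in
/-- The Brouwer degree `deg (f, Ω, y)` in a finite-dimensional space. If `f` is `C¹` in `Ω` and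
`y` is a regular value, it is the signed number of solutions of `f x = y` in `Ω`; in general it
is the signed number of solutions for a regular approximation of `f` (all of them give the same
number). The value is `0` by convention if the triple is not admissible. -/
def brouwerDegree [FiniteDimensional ℝ E] (f : E → E) (Ω : Set E) (y : E) : ℤ :=
  if DegreeAdmissible f Ω y then
    if IsRegularOn f Ω y then signedCount f Ω y
    else Classical.epsilon fun d : ℤ => ∃ g : E → E, IsRegularApprox f g Ω y ∧ signedCount g Ω y = d
  else 0

end Degree

section Graph

variable {V : Type*} [Fintype V]

/-- The Laplacian `Δu(x) = (1 / μ(x)) ∑_{y ∼ x} w_{xy} (u(y) - u(x))` of a weighted graph. -/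
def laplacian (G : SimpleGraph V) [DecidableRel G.Adj] (μ : V → ℝ) (w : V → V → ℝ)
    (u : V → ℝ) (x : V) : ℝ :=
  (1 / μ x) * ∑ y ∈ G.neighborFinset x, w x y * (u y - u x)

/-- The map `F(u) = -Δu + h₁ e^{Au} + h₂ e^{-Bu}` on `V → ℝ`, which carries the sup norm. -/
def tzitzeicaMap (G : SimpleGraph V) [DecidableRel G.Adj] (μ : V → ℝ) (w : V → V → ℝ)
    (h₁ h₂ : V → ℝ) (A B : ℝ) (u : V → ℝ) : V → ℝ := fun x =>
  -laplacian G μ w u x + h₁ x * Real.exp (A * u x) + h₂ x * Real.exp (-B * u x)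

/-- The topological degree `d_{h₁,h₂} = lim_{R → +∞} deg (F, B_R, 0)`, where `B_R` is the open
ball of radius `R` about `0` for the sup norm. -/
def tzitzeicaDegree (G : SimpleGraph V) [DecidableRel G.Adj] (μ : V → ℝ) (w : V → V → ℝ)
    (h₁ h₂ : V → ℝ) (A B : ℝ) : ℤ :=
  limUnder atTop fun R : ℝ =>
    brouwerDegree (tzitzeicaMap G μ w h₁ h₂ A B) (Metric.ball 0 R) 0

/-- The degree on large balls is well defined and independent of the radius: for all large `R`
the triple `(F, B_R, 0)` is admissible and its degree is the limit `d_{h₁,h₂}`. -/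
def DegreeWellDefined (G : SimpleGraph V) [DecidableRel G.Adj] (μ : V → ℝ) (w : V → V → ℝ)
    (h₁ h₂ : V → ℝ) (A B : ℝ) : Prop :=
  ∃ K : ℝ, ∀ R : ℝ, K < R →
    DegreeAdmissible (tzitzeicaMap G μ w h₁ h₂ A B) (Metric.ball 0 R) 0 ∧
    brouwerDegree (tzitzeicaMap G μ w h₁ h₂ A B) (Metric.ball 0 R) 0 =
      tzitzeicaDegree G μ w h₁ h₂ A B

end Graph

end Tzitzeica

end

/-!
Everything rests on the maximum principle: `Δu ≤ 0` at a maximum point of `u`. It gives a comparison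
principle for `u ↦ -Δu + f(·, u)` when each `f x` is strictly increasing: `F u ≤ F v` implies
`u ≤ v`.

If `h₂ < 0`, the nonlinearity `h₁ e^{At} + h₂ e^{-Bt}` increases strictly from `-∞` to `+∞`. By
comparison `F` is injective, comparison with constants makes it proper, and comparison for the
linearized map shows that no operator on the segment from the identity to `DF(u)` has a kernel, so
that `det DF(u) > 0`. The range of `F` is therefore open and closed, and the unique zero of `F`
counts `+1`. If `h₂ ≥ 0`, then `F u > 0` at a maximum point of `u`, and `F` has no zero.
-/

namespace Tzitzeica

section Analysis

variable {E F : Type*} [NormedAddCommGroup E] [NormedSpace ℝ E]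
  [NormedAddCommGroup F] [NormedSpace ℝ F]

theorem det_pos_of_forall_mem_segment_injective [FiniteDimensional ℝ E] {L : E →L[ℝ] E}
    (hL : ∀ T ∈ segment ℝ (ContinuousLinearMap.id ℝ E) L, Function.Injective T) :
    0 < L.det := by
  by_contra! hneg
  have hid : (ContinuousLinearMap.id ℝ E).det = 1 := LinearMap.det_id
  obtain ⟨T, hT, hdet⟩ := (convex_segment _ _).isPreconnected.intermediate_value
    (right_mem_segment ℝ _ L) (left_mem_segment ℝ _ L)
    ContinuousLinearMap.continuous_det.continuousOn ⟨hneg, hid ▸ zero_le_one⟩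
  exact (LinearMap.bot_lt_ker_of_det_eq_zero hdet).ne' (LinearMap.ker_eq_bot.2 (hL T hT))

theorem surjective_of_isProperMap_of_surjective_fderiv [CompleteSpace E] [CompleteSpace F]
    {f : E → F} (hf : ContDiff ℝ 1 f) (hproper : IsProperMap f)
    (hsurj : ∀ x, Function.Surjective (fderiv ℝ f x)) : Function.Surjective f := by
  have hopen : IsOpenMap f := IsOpenMap.of_nhds_le fun x =>
    ((hf.contDiffAt.hasStrictFDerivAt one_ne_zero).map_nhds_eq_of_surj
      (LinearMap.range_eq_top.2 (hsurj x))).ge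
  exact Set.range_eq_univ.1 <| IsClopen.eq_univ
    ⟨hproper.isClosedMap.isClosed_range, hopen.isOpen_range⟩ (Set.range_nonempty f)

end Analysis

section Degree

variable {E : Type*} [NormedAddCommGroup E] {f : E → E} {Ω : Set E} {x₀ y : E}

theorem degreeAdmissible_of_preimage_subset (hΩ : IsOpen Ω) (hb : Bornology.IsBounded Ω)
    (hf : ContinuousOn f (closure Ω)) (h : f ⁻¹' {y} ⊆ Ω) : DegreeAdmissible f Ω y where
  isOpen := hΩ
  isBounded := hb
  continuousOn := hf
  notMem_boundary := by
    rintro ⟨x, hx, hxy⟩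
    exact (hΩ.frontier_eq ▸ hx).2 (h hxy)

variable [NormedSpace ℝ E] [FiniteDimensional ℝ E]

theorem brouwerDegree_eq_signedCount (hadm : DegreeAdmissible f Ω y) (hreg : IsRegularOn f Ω y) :
    brouwerDegree f Ω y = signedCount f Ω y := by
  rw [brouwerDegree, if_pos hadm, if_pos hreg]

theorem brouwerDegree_eq_zero_of_forall_ne (hadm : DegreeAdmissible f Ω y) (hf : ContDiffOn ℝ 1 f Ω)
    (h : ∀ x ∈ Ω, f x ≠ y) : brouwerDegree f Ω y = 0 := by
  have hempty : {x | x ∈ Ω ∧ f x = y} = ∅ :=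
    Set.eq_empty_of_forall_notMem fun x hx => h x hx.1 hx.2
  rw [brouwerDegree_eq_signedCount hadm ⟨hf, fun x hx hxy => absurd hxy (h x hx)⟩, signedCount,
    hempty, finsum_mem_empty]

theorem brouwerDegree_eq_one_of_unique (hadm : DegreeAdmissible f Ω y) (hf : ContDiffOn ℝ 1 f Ω)
    (hx₀ : x₀ ∈ Ω) (h : ∀ x ∈ Ω, f x = y ↔ x = x₀) (hdet : 0 < (fderiv ℝ f x₀).det) :
    brouwerDegree f Ω y = 1 := by
  have hsingleton : {x | x ∈ Ω ∧ f x = y} = {x₀} := by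
    ext x
    exact ⟨fun hx => (h x hx.1).1 hx.2, fun hx => hx ▸ ⟨hx₀, (h x₀ hx₀).2 rfl⟩⟩
  have hreg : IsRegularOn f Ω y :=
    ⟨hf, fun x hx hxy => ((h x hx).1 hxy) ▸ hdet.ne'⟩
  rw [brouwerDegree_eq_signedCount hadm hreg, signedCount, hsingleton, finsum_mem_singleton,
    sign_pos hdet, SignType.coe_one]

end Degree

section Laplacian

variable {V : Type*} [Fintype V] {G : SimpleGraph V} [DecidableRel G.Adj] {μ : V → ℝ}
  {w : V → V → ℝ}

theorem isLinearMap_laplacian : IsLinearMap ℝ (laplacian G μ w) where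
  map_add u v := by
    ext x
    simp only [laplacian, Pi.add_apply, ← mul_add, ← Finset.sum_add_distrib]
    exact congrArg _ (Finset.sum_congr rfl fun y _ => by ring)
  map_smul c u := by
    ext x
    simp only [laplacian, Pi.smul_apply, smul_eq_mul]
    rw [mul_left_comm c, Finset.mul_sum _ _ c]
    exact congrArg _ (Finset.sum_congr rfl fun y _ => by ring)

theorem laplacian_smul_weight (c : ℝ) (u : V → ℝ) :
    laplacian G μ (c • w) u = c • laplacian G μ w u := by
  ext x
  simp only [laplacian, Pi.smul_apply, smul_eq_mul, mul_assoc]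
  rw [← Finset.mul_sum, mul_left_comm]

theorem laplacian_const (c : ℝ) : laplacian G μ w (Function.const V c) = 0 := by
  ext x
  simp [laplacian]

theorem laplacian_nonpos_of_forall_le {u : V → ℝ} {x : V} (hμ : 0 < μ x)
    (hw : ∀ y, G.Adj x y → 0 ≤ w x y) (hu : ∀ y, u y ≤ u x) : laplacian G μ w u x ≤ 0 :=
  mul_nonpos_of_nonneg_of_nonpos (one_div_pos.2 hμ).le <| Finset.sum_nonpos fun y hy =>
    mul_nonpos_of_nonneg_of_nonpos (hw y ((G.mem_neighborFinset x y).1 hy)) (sub_nonpos.2 (hu y))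

end Laplacian

section SemilinearMap

variable {V : Type*} [Fintype V] (G : SimpleGraph V) [DecidableRel G.Adj] (μ : V → ℝ)
  (w : V → V → ℝ) (f : V → ℝ → ℝ)

/-- The semilinear operator `u ↦ -Δu + f(·, u)` on a weighted graph. It covers both `tzitzeicaMap`
and, with `f x t = c x * t`, the linearizations of such operators. -/
noncomputable def semilinearMap (u : V → ℝ) : V → ℝ := fun x => -laplacian G μ w u x + f x (u x)

variable {G μ w f}

theorem semilinearMap_const (c : ℝ) :
    semilinearMap G μ w f (Function.const V c) = fun x => f x c := by
  ext x
  simp [semilinearMap, laplacian_const]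

theorem contDiff_semilinearMap {n : WithTop ℕ∞} (hf : ∀ x, ContDiff ℝ n (f x)) :
    ContDiff ℝ n (semilinearMap G μ w f) := by
  unfold semilinearMap laplacian
  fun_prop

theorem continuous_semilinearMap (hf : ∀ x, Continuous (f x)) :
    Continuous (semilinearMap G μ w f) :=
  contDiff_zero.1 (contDiff_semilinearMap fun x => contDiff_zero.2 (hf x))

theorem fderiv_semilinearMap_apply {u : V → ℝ} (hf : ∀ x, DifferentiableAt ℝ (f x) (u x))
    (v : V → ℝ) :
    fderiv ℝ (semilinearMap G μ w f) u v =
      semilinearMap G μ w (fun x t => deriv (f x) (u x) * t) v := by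
  have hlap : HasFDerivAt (laplacian G μ w)
      (isLinearMap_laplacian.mk' (laplacian G μ w)).toContinuousLinearMap u :=
    (isLinearMap_laplacian.mk' (laplacian G μ w)).toContinuousLinearMap.hasFDerivAt
  have hF : HasFDerivAt (semilinearMap G μ w f) _ u := hasFDerivAt_pi.2 fun x =>
    (hasFDerivAt_pi'.1 hlap x).neg.add
      ((hf x).hasDerivAt.comp_hasFDerivAt u (hasFDerivAt_apply x u))
  rw [hF.fderiv]
  rfl

theorem le_of_semilinearMap_le (hμ : ∀ x, 0 < μ x) (hw : ∀ x y, G.Adj x y → 0 ≤ w x y)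
    (hf : ∀ x, StrictMono (f x)) {u v : V → ℝ}
    (h : semilinearMap G μ w f u ≤ semilinearMap G μ w f v) : u ≤ v := by
  intro z
  have : Nonempty V := ⟨z⟩
  obtain ⟨x, hx⟩ := Finite.exists_max (u - v)
  have hlap : laplacian G μ w u x - laplacian G μ w v x ≤ 0 := by
    simpa only [isLinearMap_laplacian.map_sub, Pi.sub_apply] using
      laplacian_nonpos_of_forall_le (hμ x) (hw x) hx
  have hfx : f x (u x) ≤ f x (v x) := by
    have := h x
    simp only [semilinearMap] at this
    linarith
  exact sub_nonpos.1 ((hx z).trans (sub_nonpos.2 ((hf x).le_iff_le.1 hfx)))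

theorem semilinearMap_injective (hμ : ∀ x, 0 < μ x) (hw : ∀ x y, G.Adj x y → 0 ≤ w x y)
    (hf : ∀ x, StrictMono (f x)) : Function.Injective (semilinearMap G μ w f) := fun _ _ h =>
  le_antisymm (le_of_semilinearMap_le hμ hw hf h.le) (le_of_semilinearMap_le hμ hw hf h.ge)

theorem isProperMap_semilinearMap (hμ : ∀ x, 0 < μ x) (hw : ∀ x y, G.Adj x y → 0 ≤ w x y)
    (hf : ∀ x, StrictMono (f x)) (hcont : ∀ x, Continuous (f x))
    (htop : ∀ x, Tendsto (f x) atTop atTop) (hbot : ∀ x, Tendsto (f x) atBot atBot) :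
    IsProperMap (semilinearMap G μ w f) := by
  have hF : Continuous (semilinearMap G μ w f) := continuous_semilinearMap hcont
  refine isProperMap_iff_isCompact_preimage.2 ⟨hF, fun K hK => ?_⟩
  obtain ⟨a, ha⟩ := hK.isBounded.bddBelow
  obtain ⟨b, hb⟩ := hK.isBounded.bddAbove
  obtain ⟨s, hs⟩ := (eventually_all.2 fun x => (hbot x).eventually_le_atBot (a x)).exists
  obtain ⟨t, ht⟩ := (eventually_all.2 fun x => (htop x).eventually_ge_atTop (b x)).exists
  have hlower : ∀ u ∈ semilinearMap G μ w f ⁻¹' K, Function.const V s ≤ u := fun u hu =>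
    le_of_semilinearMap_le hμ hw hf <| (semilinearMap_const s).trans_le (le_trans hs (ha hu))
  have hupper : ∀ u ∈ semilinearMap G μ w f ⁻¹' K, u ≤ Function.const V t := fun u hu =>
    le_of_semilinearMap_le hμ hw hf <| (le_trans (hb hu) ht).trans_eq (semilinearMap_const t).symm
  exact isCompact_Icc.of_isClosed_subset (hK.isClosed.preimage hF)
    fun u hu => ⟨hlower u hu, hupper u hu⟩

theorem injective_of_mem_segment_id_fderiv_semilinearMap (hμ : ∀ x, 0 < μ x)
    (hw : ∀ x y, G.Adj x y → 0 ≤ w x y) {u : V → ℝ} (hf : ∀ x, 0 < deriv (f x) (u x))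
    {T : (V → ℝ) →L[ℝ] (V → ℝ)}
    (hT : T ∈ segment ℝ (ContinuousLinearMap.id ℝ (V → ℝ)) (fderiv ℝ (semilinearMap G μ w f) u)) :
    Function.Injective T := by
  obtain ⟨a, b, ha, hb, hab, rfl⟩ := hT
  have hcoe : ⇑(a • ContinuousLinearMap.id ℝ (V → ℝ) + b • fderiv ℝ (semilinearMap G μ w f) u) =
      semilinearMap G μ (b • w) fun x t => (a + b * deriv (f x) (u x)) * t := by
    ext v x
    have hdiff : ∀ x, DifferentiableAt ℝ (f x) (u x) :=
      fun x => differentiableAt_of_deriv_ne_zero (hf x).ne'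
    simp only [add_apply, smul_apply, ContinuousLinearMap.coe_id', id_eq, Pi.add_apply,
      Pi.smul_apply, smul_eq_mul, fderiv_semilinearMap_apply hdiff, semilinearMap,
      laplacian_smul_weight]
    ring
  have hpos : ∀ x, 0 < a + b * deriv (f x) (u x) := fun x => by
    rcases hb.eq_or_lt with rfl | hb
    · linarith
    · exact add_pos_of_nonneg_of_pos ha (mul_pos hb (hf x))
  rw [hcoe]
  exact semilinearMap_injective hμ (fun x y hxy => mul_nonneg hb (hw x y hxy))
    fun x => strictMono_mul_left_of_pos (hpos x)

theorem det_fderiv_semilinearMap_pos (hμ : ∀ x, 0 < μ x) (hw : ∀ x y, G.Adj x y → 0 ≤ w x y)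
    {u : V → ℝ} (hf : ∀ x, 0 < deriv (f x) (u x)) :
    0 < (fderiv ℝ (semilinearMap G μ w f) u).det :=
  det_pos_of_forall_mem_segment_injective fun _ =>
    injective_of_mem_segment_id_fderiv_semilinearMap hμ hw hf

theorem semilinearMap_bijective (hμ : ∀ x, 0 < μ x) (hw : ∀ x y, G.Adj x y → 0 ≤ w x y)
    (hf : ∀ x, ContDiff ℝ 1 (f x)) (hderiv : ∀ x t, 0 < deriv (f x) t)
    (htop : ∀ x, Tendsto (f x) atTop atTop) (hbot : ∀ x, Tendsto (f x) atBot atBot) :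
    Function.Bijective (semilinearMap G μ w f) := by
  have hmono : ∀ x, StrictMono (f x) := fun x => strictMono_of_deriv_pos (hderiv x)
  refine ⟨semilinearMap_injective hμ hw hmono, surjective_of_isProperMap_of_surjective_fderiv
    (contDiff_semilinearMap hf)
    (isProperMap_semilinearMap hμ hw hmono (fun x => (hf x).continuous) htop hbot) fun u => ?_⟩
  exact LinearMap.injective_iff_surjective.1 <|
    injective_of_mem_segment_id_fderiv_semilinearMap hμ hw (fun x => hderiv x (u x))
      (right_mem_segment ℝ _ _)

theorem semilinearMap_ne_zero [Nonempty V] (hμ : ∀ x, 0 < μ x)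
    (hw : ∀ x y, G.Adj x y → 0 ≤ w x y) (hf : ∀ x t, 0 < f x t) (u : V → ℝ) :
    semilinearMap G μ w f u ≠ 0 := by
  obtain ⟨x, hx⟩ := Finite.exists_max u
  have hlap := laplacian_nonpos_of_forall_le (hμ x) (hw x) hx
  exact fun h => (add_pos_of_nonneg_of_pos (neg_nonneg.2 hlap) (hf x (u x))).ne' (congrFun h x)

end SemilinearMap

section TzitzeicaMap

/-- The Tzitzéica nonlinearity `f(x, t) = h₁(x) e^{At} + h₂(x) e^{-Bt}`, for which `tzitzeicaMap` is
the semilinear operator `u ↦ -Δu + f(·, u)`. -/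
noncomputable def tzitzeicaNonlinearity {V : Type*} (h₁ h₂ : V → ℝ) (A B : ℝ) (x : V) (t : ℝ) :
    ℝ :=
  h₁ x * Real.exp (A * t) + h₂ x * Real.exp (-B * t)

section Nonlinearity

variable {V : Type*} {h₁ h₂ : V → ℝ} {A B : ℝ} {x : V}

theorem contDiff_tzitzeicaNonlinearity {n : WithTop ℕ∞} :
    ContDiff ℝ n (tzitzeicaNonlinearity h₁ h₂ A B x) := by
  unfold tzitzeicaNonlinearity
  fun_prop

theorem tzitzeicaNonlinearity_pos (hh₁ : 0 < h₁ x) (hh₂ : 0 ≤ h₂ x) (t : ℝ) :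
    0 < tzitzeicaNonlinearity h₁ h₂ A B x t := by
  unfold tzitzeicaNonlinearity
  positivity

theorem deriv_tzitzeicaNonlinearity_pos (hh₁ : 0 < h₁ x) (hh₂ : h₂ x < 0) (hA : 0 < A)
    (hB : 0 < B) (t : ℝ) : 0 < deriv (tzitzeicaNonlinearity h₁ h₂ A B x) t := by
  have hexp (c : ℝ) : HasDerivAt (fun t => Real.exp (c * t)) (Real.exp (c * t) * c) t := by
    simpa using ((hasDerivAt_id t).const_mul c).exp
  have hderiv : HasDerivAt (tzitzeicaNonlinearity h₁ h₂ A B x)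
      (h₁ x * (Real.exp (A * t) * A) + h₂ x * (Real.exp (-B * t) * -B)) t :=
    ((hexp A).const_mul _).add ((hexp (-B)).const_mul _)
  rw [hderiv.deriv]
  exact add_pos (by positivity) <| mul_pos_of_neg_of_neg hh₂ <|
    mul_neg_of_pos_of_neg (Real.exp_pos _) (neg_neg_of_pos hB)

theorem tendsto_tzitzeicaNonlinearity_atTop (hh₁ : 0 < h₁ x) (hA : 0 < A) (hB : 0 < B) :
    Tendsto (tzitzeicaNonlinearity h₁ h₂ A B x) atTop atTop :=
  ((Real.tendsto_exp_atTop.comp (tendsto_id.const_mul_atTop hA)).const_mul_atTop hh₁).atTop_add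
    ((Real.tendsto_exp_atBot.comp
      (tendsto_id.const_mul_atTop_of_neg (neg_neg_of_pos hB))).const_mul (h₂ x))

theorem tendsto_tzitzeicaNonlinearity_atBot (hh₂ : h₂ x < 0) (hA : 0 < A) (hB : 0 < B) :
    Tendsto (tzitzeicaNonlinearity h₁ h₂ A B x) atBot atBot :=
  ((Real.tendsto_exp_atBot.comp (tendsto_id.const_mul_atBot hA)).const_mul (h₁ x)).add_atBot
    ((Real.tendsto_exp_atTop.comp
      (tendsto_id.const_mul_atBot_of_neg (neg_neg_of_pos hB))).const_mul_atTop_of_neg hh₂)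

end Nonlinearity

variable {V : Type*} [Fintype V] {G : SimpleGraph V} [DecidableRel G.Adj] {μ : V → ℝ}
  {w : V → V → ℝ} {h₁ h₂ : V → ℝ} {A B : ℝ}

theorem tzitzeicaMap_eq_semilinearMap :
    tzitzeicaMap G μ w h₁ h₂ A B = semilinearMap G μ w (tzitzeicaNonlinearity h₁ h₂ A B) := by
  ext u x
  exact add_assoc _ _ _

theorem contDiff_tzitzeicaMap {n : WithTop ℕ∞} : ContDiff ℝ n (tzitzeicaMap G μ w h₁ h₂ A B) := by
  rw [tzitzeicaMap_eq_semilinearMap]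
  exact contDiff_semilinearMap fun _ => contDiff_tzitzeicaNonlinearity

theorem tzitzeicaMap_bijective (hμ : ∀ x, 0 < μ x) (hw : ∀ x y, G.Adj x y → 0 ≤ w x y)
    (hh₁ : ∀ x, 0 < h₁ x) (hh₂ : ∀ x, h₂ x < 0) (hA : 0 < A) (hB : 0 < B) :
    Function.Bijective (tzitzeicaMap G μ w h₁ h₂ A B) := by
  rw [tzitzeicaMap_eq_semilinearMap]
  exact semilinearMap_bijective hμ hw
    (fun _ => contDiff_tzitzeicaNonlinearity)
    (fun x => deriv_tzitzeicaNonlinearity_pos (hh₁ x) (hh₂ x) hA hB)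
    (fun x => tendsto_tzitzeicaNonlinearity_atTop (hh₁ x) hA hB)
    (fun x => tendsto_tzitzeicaNonlinearity_atBot (hh₂ x) hA hB)

theorem det_fderiv_tzitzeicaMap_pos (hμ : ∀ x, 0 < μ x) (hw : ∀ x y, G.Adj x y → 0 ≤ w x y)
    (hh₁ : ∀ x, 0 < h₁ x) (hh₂ : ∀ x, h₂ x < 0) (hA : 0 < A) (hB : 0 < B) (u : V → ℝ) :
    0 < (fderiv ℝ (tzitzeicaMap G μ w h₁ h₂ A B) u).det := by
  rw [tzitzeicaMap_eq_semilinearMap]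
  exact det_fderiv_semilinearMap_pos hμ hw
    fun x => deriv_tzitzeicaNonlinearity_pos (hh₁ x) (hh₂ x) hA hB (u x)

theorem tzitzeicaMap_ne_zero [Nonempty V] (hμ : ∀ x, 0 < μ x)
    (hw : ∀ x y, G.Adj x y → 0 ≤ w x y) (hh₁ : ∀ x, 0 < h₁ x) (hh₂ : ∀ x, 0 ≤ h₂ x) (u : V → ℝ) :
    tzitzeicaMap G μ w h₁ h₂ A B u ≠ 0 := by
  rw [tzitzeicaMap_eq_semilinearMap]
  exact semilinearMap_ne_zero hμ hw (fun x => tzitzeicaNonlinearity_pos (hh₁ x) (hh₂ x)) u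

theorem degreeAdmissible_tzitzeicaMap_ball {R : ℝ}
    (h : ∀ u, tzitzeicaMap G μ w h₁ h₂ A B u = 0 → ‖u‖ < R) :
    DegreeAdmissible (tzitzeicaMap G μ w h₁ h₂ A B) (Metric.ball 0 R) 0 :=
  degreeAdmissible_of_preimage_subset Metric.isOpen_ball Metric.isBounded_ball
    (contDiff_tzitzeicaMap (n := 0)).continuous.continuousOn
    fun u hu => mem_ball_zero_iff.2 (h u hu)

theorem degreeWellDefined_and_tzitzeicaDegree_eq {K : ℝ} {d : ℤ}
    (hadm : ∀ R, K < R → DegreeAdmissible (tzitzeicaMap G μ w h₁ h₂ A B) (Metric.ball 0 R) 0)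
    (hdeg : ∀ R, K < R → brouwerDegree (tzitzeicaMap G μ w h₁ h₂ A B) (Metric.ball 0 R) 0 = d) :
    DegreeWellDefined G μ w h₁ h₂ A B ∧ tzitzeicaDegree G μ w h₁ h₂ A B = d := by
  have hlim : tzitzeicaDegree G μ w h₁ h₂ A B = d := (tendsto_const_nhds.congr' <|
    (eventually_gt_atTop K).mono fun R hR => (hdeg R hR).symm).limUnder_eq
  exact ⟨⟨K, fun R hR => ⟨hadm R hR, (hdeg R hR).trans hlim.symm⟩⟩, hlim⟩

theorem degreeWellDefined_and_tzitzeicaDegree_eq_one {u : V → ℝ}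
    (hu : ∀ v, tzitzeicaMap G μ w h₁ h₂ A B v = 0 ↔ v = u)
    (hdet : 0 < (fderiv ℝ (tzitzeicaMap G μ w h₁ h₂ A B) u).det) :
    DegreeWellDefined G μ w h₁ h₂ A B ∧ tzitzeicaDegree G μ w h₁ h₂ A B = 1 := by
  have hadm : ∀ R, ‖u‖ < R →
      DegreeAdmissible (tzitzeicaMap G μ w h₁ h₂ A B) (Metric.ball 0 R) 0 := fun R hR =>
    degreeAdmissible_tzitzeicaMap_ball fun v hv => (hu v).1 hv ▸ hR
  exact degreeWellDefined_and_tzitzeicaDegree_eq hadm fun R hR =>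
    brouwerDegree_eq_one_of_unique (hadm R hR) contDiff_tzitzeicaMap.contDiffOn
      (mem_ball_zero_iff.2 hR) (fun v _ => hu v) hdet

theorem degreeWellDefined_and_tzitzeicaDegree_eq_zero
    (h : ∀ u, tzitzeicaMap G μ w h₁ h₂ A B u ≠ 0) :
    DegreeWellDefined G μ w h₁ h₂ A B ∧ tzitzeicaDegree G μ w h₁ h₂ A B = 0 := by
  have hadm (R : ℝ) : DegreeAdmissible (tzitzeicaMap G μ w h₁ h₂ A B) (Metric.ball 0 R) 0 :=
    degreeAdmissible_tzitzeicaMap_ball fun u hu => absurd hu (h u)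
  exact degreeWellDefined_and_tzitzeicaDegree_eq (K := 0) (fun R _ => hadm R) fun R _ =>
    brouwerDegree_eq_zero_of_forall_ne (hadm R) contDiff_tzitzeicaMap.contDiffOn fun u _ => h u

end TzitzeicaMap

end Tzitzeica

theorem theorem1_general {V : Type*} [Fintype V] [Nonempty V] (G : SimpleGraph V)
    [DecidableRel G.Adj]
    (μ : V → ℝ) (hμ : ∀ x, 0 < μ x)
    (w : V → V → ℝ) (hw : ∀ x y, G.Adj x y → 0 ≤ w x y)
    (h₁ h₂ : V → ℝ) (hh₁ : ∀ x, 0 < h₁ x) (A B : ℝ) :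
    (0 < A → 0 < B → (∀ x, h₂ x < 0) →
      Tzitzeica.DegreeWellDefined G μ w h₁ h₂ A B ∧
      Tzitzeica.tzitzeicaDegree G μ w h₁ h₂ A B = 1 ∧
      ∃ u : V → ℝ, ∀ x,
        -Tzitzeica.laplacian G μ w u x + h₁ x * Real.exp (A * u x)
          + h₂ x * Real.exp (-B * u x) = 0) ∧
    ((∀ x, 0 ≤ h₂ x) →
      Tzitzeica.DegreeWellDefined G μ w h₁ h₂ A B ∧
      Tzitzeica.tzitzeicaDegree G μ w h₁ h₂ A B = 0) := by
  refine ⟨fun hA hB hh₂ => ?_, fun hh₂ =>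
    Tzitzeica.degreeWellDefined_and_tzitzeicaDegree_eq_zero
      (Tzitzeica.tzitzeicaMap_ne_zero hμ hw hh₁ hh₂)⟩
  have hbij := Tzitzeica.tzitzeicaMap_bijective hμ hw hh₁ hh₂ hA hB
  obtain ⟨u, hu⟩ := hbij.surjective 0
  obtain ⟨hwell, hdeg⟩ := Tzitzeica.degreeWellDefined_and_tzitzeicaDegree_eq_one
    (fun v => by rw [← hu, hbij.injective.eq_iff])
    (Tzitzeica.det_fderiv_tzitzeicaMap_pos hμ hw hh₁ hh₂ hA hB u)
  exact ⟨hwell, hdeg, u, congrFun hu⟩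

theorem theorem1 {V : Type*} [Fintype V] (G : SimpleGraph V) [DecidableRel G.Adj]
    (hG : G.Connected)
    (μ : V → ℝ) (hμ : ∀ x, 0 < μ x)
    (w : V → V → ℝ) (hw_symm : ∀ x y, G.Adj x y → w x y = w y x)
    (hw_pos : ∀ x y, G.Adj x y → 0 < w x y)
    (h₁ h₂ : V → ℝ) (hh₁ : ∀ x, 0 < h₁ x)
    (A B : ℝ) (hA : 0 < A) (hB : 0 < B) :
    ((∀ x, h₂ x < 0) →
      Tzitzeica.DegreeWellDefined G μ w h₁ h₂ A B ∧
      Tzitzeica.tzitzeicaDegree G μ w h₁ h₂ A B = 1 ∧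
      ∃ u : V → ℝ, ∀ x,
        -Tzitzeica.laplacian G μ w u x + h₁ x * Real.exp (A * u x)
          + h₂ x * Real.exp (-B * u x) = 0) ∧
    ((∀ x, 0 < h₂ x) →
      Tzitzeica.DegreeWellDefined G μ w h₁ h₂ A B ∧
      Tzitzeica.tzitzeicaDegree G μ w h₁ h₂ A B = 0) := by
  have := hG.nonempty
  exact (theorem1_general G μ hμ w (fun x y h => (hw_pos x y h).le) h₁ h₂ hh₁ A B).imp
    (fun H => H hA hB) fun H hh₂ => H fun x => (hh₂ x).le
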